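/- All graphs are finite and undirected and may have multiple edges. A 2-terminal graph $(G,s,t)$ is a graph $G$ with two distinct distinguished vertices $s,t$ (its terminals). Given 2-terminal graphs $(G_1,s_1,t_1)$ and $(G_2,s_2,t_2)$ on disjoint vertex sets, their parallel composition is $(H,s_1,t_1)$, where $H$ is obtained from $G_1\cup G_2$ by identifying $s_2$ with $s_1$ and $t_2$ with $t_1$; their series composition is $(H,s_1,t_2)$, where $H$ is obtained from $G_1\cup G_2$ by identifying $t_1$ with $s_2$. The Wheatstone bridge $\mathsf W$ is the 2-terminal graph obtained from $K_4$ minus an edge by taking its two vertices of degree $2$ as terminals. For distinct vertices $x,y$ of $G$ let $\lambda_G(x,y)$ be the maximum number of pairwise edge-disjoint paths from $x$ to $y$; the maxmaxflow of $G$ is $\max_{x\ne y}\lambda_G(x,y)$. The chromatic polynomial of $G=(V,E)$ is $P_G(q)=\sum_{A\subseteq E}(-1)^{|A|}q^{k(A)}$, where $k(A)$ is the number of connected components of $(V,A)$. **Theorem 1.6.** Let $(G,s,t)$ be a 2-terminal graph that can be obtained from $K_2$ (with its two vertices as terminals) and the Wheatstone bridge $\mathsf W$ by successive series and parallel compositions,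 and let $\Lambda\ge 3$ be an integer. If $G$ has maxmaxflow at most $\Lambda$, then all the roots (real or complex) of the chromatic polynomial $P_G(q)$ lie in the disc $$|q-1| < \frac{\Lambda-\log 2}{\log 2}.$$ -/

import Mathlib

open scoped Graph Polynomial

namespace Graph

variable {α β : Type*}

/-- The number of connected components of a multigraph. -/
noncomputable def numComponents (G : Graph α β) : ℕ :=
  Nat.card G.toSimpleGraph.ConnectedComponent

/-- The multivariate Tutte polynomial `∑_{A ⊆ E(G)} q ^ k(A) ∏_{e ∈ A} v_e` of a finite multigraph,
with edge weights `v_e` in a commutative ring, as a polynomial in the indeterminate `q`.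
Here `k(A)` is the number of connected components of the spanning subgraph `(V(G), A)`. -/
noncomputable def multivariateTutte {R : Type*} [CommRing R] (G : Graph α β) (v : β → R) : R[X] :=
  ∑ᶠ (A : Finset β) (_ : (A : Set β) ⊆ E(G)),
    Polynomial.C (∏ e ∈ A, v e) * Polynomial.X ^ (G.restrict (A : Set β)).numComponents

/-- The chromatic polynomial of a finite multigraph:
the multivariate Tutte polynomial with all edge weights equal to `-1`. -/
noncomputable def chromaticPolynomial (G : Graph α β) : ℤ[X] :=
  G.multivariateTutte fun _ ↦ (-1 : ℤ)

/-- `G.IsPath x y vs es`: there is a path in `G` from `x` to `y`, with list of (pairwise distinct)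
vertices `vs` and list of edges `es`, both in the order in which they are traversed. -/
inductive IsPath (G : Graph α β) : α → α → List α → List β → Prop
  | nil {x : α} (hx : x ∈ V(G)) : IsPath G x x [x] []
  | cons {x y z : α} {e : β} {vs : List α} {es : List β} (he : G.IsLink e x y)
      (hx : x ∉ vs) (hp : IsPath G y z vs es) : IsPath G x z (x :: vs) (e :: es)

/-- There are `k` pairwise edge-disjoint paths from `x` to `y` in `G`. -/
def HasEdgeDisjointPaths (G : Graph α β) (x y : α) (k : ℕ) : Prop :=
  ∃ (vs : Fin k → List α) (es : Fin k → List β),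
    (∀ i, G.IsPath x y (vs i) (es i)) ∧ Pairwise fun i j ↦ (es i).Disjoint (es j)

/-- The maximum flow from `x` to `y` (meant for `x ≠ y`):
the maximum number of pairwise edge-disjoint paths from `x` to `y` in `G`. -/
noncomputable def maxFlow (G : Graph α β) (x y : α) : ℕ∞ :=
  ⨆ (k : ℕ) (_ : G.HasEdgeDisjointPaths x y k), (k : ℕ∞)

/-- The maxmaxflow of `G`: the maximum of `G.maxFlow x y` over all pairs of distinct vertices. -/
noncomputable def maxmaxflow (G : Graph α β) : ℕ∞ :=
  ⨆ (x ∈ V(G)) (y ∈ V(G)) (_ : x ≠ y), G.maxFlow x y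

/-- `H` is the union of its edge-disjoint subgraphs `G₁` and `G₂`. -/
structure IsEdgeDisjointUnion (H G₁ G₂ : Graph α β) : Prop where
  vertexSet_eq : V(H) = V(G₁) ∪ V(G₂)
  disjoint_edgeSet : Disjoint E(G₁) E(G₂)
  isLink_iff : ∀ e x y, H.IsLink e x y ↔ G₁.IsLink e x y ∨ G₂.IsLink e x y

/-- `(G, s, t)` is the Wheatstone bridge: `K₄` minus an edge,
with the two vertices of degree two as terminals. -/
def IsWheatstoneBridge (G : Graph α β) (s t : α) : Prop :=
  ∃ (a b : α) (e : Fin 5 → β),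
    [s, a, b, t].Nodup ∧ Function.Injective e ∧
    V(G) = {s, a, b, t} ∧ E(G) = Set.range e ∧
    G.IsLink (e 0) s a ∧ G.IsLink (e 1) s b ∧ G.IsLink (e 2) a t ∧ G.IsLink (e 3) b t ∧
    G.IsLink (e 4) a b

/-- The 2-terminal graphs `(G, s, t)` that can be obtained from `K₂` and the Wheatstone bridge by
successive series and parallel compositions. The compositions are described inside the composed
graph, which fixes it up to isomorphism: the constituents are edge-disjoint subgraphs that share
exactly the vertices which the composition identifies, namely one terminal of each constituent
(a series composition) or both terminals of each (a parallel composition). -/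
inductive InWheatstoneClass : Graph α β → α → α → Prop
  | edge {s t : α} (e : β) (hst : s ≠ t) : InWheatstoneClass (Graph.banana s t {e}) s t
  | bridge {G : Graph α β} {s t : α} (h : G.IsWheatstoneBridge s t) : InWheatstoneClass G s t
  | series {H G₁ G₂ : Graph α β} {s m t : α} (h₁ : InWheatstoneClass G₁ s m)
      (h₂ : InWheatstoneClass G₂ m t) (hH : H.IsEdgeDisjointUnion G₁ G₂)
      (hV : V(G₁) ∩ V(G₂) = {m}) : InWheatstoneClass H s t
  | parallel {H G₁ G₂ : Graph α β} {s t : α} (h₁ : InWheatstoneClass G₁ s t)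
      (h₂ : InWheatstoneClass G₂ s t) (hH : H.IsEdgeDisjointUnion G₁ G₂)
      (hV : V(G₁) ∩ V(G₂) = {s, t}) : InWheatstoneClass H s t

end Graph

/-! The number of `n`-colourings of a 2-terminal graph with prescribed terminal colours is `A(n)`
when these differ and `A(n) + B(n)` when they agree, so the chromatic polynomial is `q (q A + B)`.
Put `Q = q - 1` and let `t = B / (q A + B)` be the transmissivity. In series, both `q A + B` and `t`
multiply. In parallel, `q (q A + B)` is the product of the two old denominators with `1 + Q t₁ t₂`,
and `(1 + Q t) / (1 - t)` is multiplicative. A root can therefore only arise from `1 + Q t₁ t₂ = 0`,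
which is excluded once `‖t₁‖, ‖t₂‖ ≤ 1 / ‖Q‖ < 1`.

To keep transmissivities that small, let a subgraph with `k` edge-disjoint paths between its
terminals have `t = -1 / Q` or `(1 + ‖Q‖ ‖t‖) / (1 + ‖t‖) ≤ Y ^ k`. These regions are stable under
both compositions (`InTransmissivityRegion.series`, `InTransmissivityRegion.parallel`), the
exponents adding in parallel. Maxmaxflow caps the exponent: if the terminals are also joined outside
the subgraph, then `k + 1 ≤ Λ`. Both constituents of a parallel composition are joined in this way,
so the whole graph needs no region of its own. This is the induction
`InWheatstoneClass.exists_isTerminalCount`.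

With `ρ = 1 / ‖Q‖`, the choice `Y = exp (ρ - ρ ^ 2)` handles two edges in series, the bridge, and
the cap `k ≤ Λ - 1` everywhere outside the disc. -/

namespace Graph

variable {α β : Type*} {G H G₁ G₂ : Graph α β} {x y z s t m : α} {vs : List α} {es : List β}

/-! ### Paths -/

lemma IsPath.left_mem (h : G.IsPath x y vs es) : x ∈ V(G) := by
  cases h with
  | nil hx => exact hx
  | cons he => exact he.left_mem

lemma IsPath.right_mem (h : G.IsPath x y vs es) : y ∈ V(G) := by
  induction h with
  | nil hx => exact hx
  | cons _ _ _ ih => exact ih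

lemma IsPath.edge_mem (h : G.IsPath x y vs es) {e : β} (he : e ∈ es) : e ∈ E(G) := by
  induction h with
  | nil => simp at he
  | cons hl _ _ ih =>
    rcases List.mem_cons.1 he with rfl | he
    · exact hl.edge_mem
    · exact ih he

lemma IsPath.mono (hle : G ≤ H) (h : G.IsPath x y vs es) : H.IsPath x y vs es := by
  induction h with
  | nil hx => exact .nil (hle.vertexSet_mono hx)
  | cons hl hx _ ih => exact .cons (hl.mono hle) hx ih

lemma IsPath.exists_suffix (h : G.IsPath y z vs es) (hx : x ∈ vs) :
    ∃ vs' es', G.IsPath x z vs' es' ∧ es' ⊆ es := by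
  induction h with
  | nil hy =>
    obtain rfl := List.mem_singleton.1 hx
    exact ⟨_, _, .nil hy, List.Subset.refl _⟩
  | cons hl hn hp ih =>
    rcases List.mem_cons.1 hx with rfl | hx
    · exact ⟨_, _, .cons hl hn hp, List.Subset.refl _⟩
    · obtain ⟨vs', es', h, hs⟩ := ih hx
      exact ⟨vs', es', h, List.subset_cons_of_subset _ hs⟩

lemma IsPath.exists_cons {e : β} (he : G.IsLink e x y) (h : G.IsPath y z vs es) :
    ∃ vs' es', G.IsPath x z vs' es' ∧ es' ⊆ e :: es := by
  by_cases hx : x ∈ vs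
  · obtain ⟨vs', es', h, hs⟩ := h.exists_suffix hx
    exact ⟨vs', es', h, List.subset_cons_of_subset _ hs⟩
  · exact ⟨_, _, .cons he hx h, List.Subset.refl _⟩

/-- Paths repeat no vertex, so loops are erased: when an edge is prepended at a vertex already
visited, the path is cut to a suffix. Only the inclusion of edges survives, which is all that
edge-disjointness needs. -/
lemma IsPath.exists_trans {vs₁ vs₂ : List α} {es₁ es₂ : List β} (h₁ : G.IsPath x y vs₁ es₁)
    (h₂ : G.IsPath y z vs₂ es₂) : ∃ vs es, G.IsPath x z vs es ∧ es ⊆ es₁ ++ es₂ := by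
  induction h₁ with
  | nil => exact ⟨_, _, h₂, by simp⟩
  | cons hl _ _ ih =>
    obtain ⟨vs', es', h, hs⟩ := ih h₂
    obtain ⟨vs'', es'', h', hs'⟩ := h.exists_cons hl
    exact ⟨vs'', es'', h', fun a ha ↦ by
      rcases List.mem_cons.1 (hs' ha) with rfl | ha
      · simp
      · exact List.mem_cons_of_mem _ (hs ha)⟩

lemma IsPath.exists_symm (h : G.IsPath x y vs es) :
    ∃ vs' es', G.IsPath y x vs' es' ∧ es' ⊆ es := by
  induction h with
  | nil hx => exact ⟨_, _, .nil hx, List.Subset.refl _⟩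
  | @cons x y z e vs es hl hn hp ih =>
    obtain ⟨vs', es', h, hs⟩ := ih
    by_cases hxy : x = y
    · subst hxy
      exact ⟨_, _, h, List.subset_cons_of_subset _ hs⟩
    have h₁ : G.IsPath y x [y, x] [e] := .cons hl.symm (by simpa using Ne.symm hxy) (.nil hl.left_mem)
    obtain ⟨vs'', es'', h', hs'⟩ := h.exists_trans h₁
    refine ⟨vs'', es'', h', fun a ha ↦ ?_⟩
    rcases List.mem_append.1 (hs' ha) with ha | ha
    · exact List.mem_cons_of_mem _ (hs ha)
    · simp_all

/-- `x` and `y` are joined by a path of `H` that uses no edge of `F`. -/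
def JoinedOff (H : Graph α β) (F : Set β) (x y : α) : Prop :=
  ∃ vs es, H.IsPath x y vs es ∧ ∀ e ∈ es, e ∉ F

lemma JoinedOff.trans {F : Set β} (h₁ : H.JoinedOff F x y) (h₂ : H.JoinedOff F y z) :
    H.JoinedOff F x z := by
  obtain ⟨_, _, p₁, d₁⟩ := h₁
  obtain ⟨_, _, p₂, d₂⟩ := h₂
  obtain ⟨vs, es, p, hs⟩ := p₁.exists_trans p₂
  refine ⟨vs, es, p, fun e he ↦ ?_⟩
  rcases List.mem_append.1 (hs he) with h | h
  exacts [d₁ e h, d₂ e h]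

lemma JoinedOff.symm {F : Set β} (h : H.JoinedOff F x y) : H.JoinedOff F y x := by
  obtain ⟨_, _, p, d⟩ := h
  obtain ⟨vs, es, p, hs⟩ := p.exists_symm
  exact ⟨vs, es, p, fun e he ↦ d e (hs he)⟩

lemma JoinedOff.anti {F F' : Set β} (hF : F' ⊆ F) (h : H.JoinedOff F x y) : H.JoinedOff F' x y := by
  obtain ⟨vs, es, p, d⟩ := h
  exact ⟨vs, es, p, fun e he hf ↦ d e he (hF hf)⟩

lemma IsPath.joinedOff {F : Set β} (hle : G ≤ H) (hF : Disjoint E(G) F) (h : G.IsPath x y vs es) :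
    H.JoinedOff F x y :=
  ⟨vs, es, h.mono hle, fun _ he ↦ Set.disjoint_left.1 hF (h.edge_mem he)⟩

/-! ### Edge-disjoint paths -/

lemma HasEdgeDisjointPaths.mono {k : ℕ} (hle : G ≤ H) (h : G.HasEdgeDisjointPaths x y k) :
    H.HasEdgeDisjointPaths x y k := by
  obtain ⟨vs, es, p, d⟩ := h
  exact ⟨vs, es, fun i ↦ (p i).mono hle, d⟩

lemma HasEdgeDisjointPaths.anti {k l : ℕ} (hl : l ≤ k) (h : G.HasEdgeDisjointPaths x y k) :
    G.HasEdgeDisjointPaths x y l := by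
  obtain ⟨vs, es, p, d⟩ := h
  exact ⟨fun i ↦ vs (i.castLE hl), fun i ↦ es (i.castLE hl), fun i ↦ p _,
    fun i j hij ↦ d fun h ↦ hij (Fin.castLE_injective hl h)⟩

lemma HasEdgeDisjointPaths.trans {k : ℕ} (hle₁ : G₁ ≤ H) (hle₂ : G₂ ≤ H)
    (hd : Disjoint E(G₁) E(G₂)) (h₁ : G₁.HasEdgeDisjointPaths x y k)
    (h₂ : G₂.HasEdgeDisjointPaths y z k) : H.HasEdgeDisjointPaths x z k := by
  obtain ⟨vs₁, es₁, p₁, d₁⟩ := h₁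
  obtain ⟨vs₂, es₂, p₂, d₂⟩ := h₂
  choose vs es p hs using fun i ↦ ((p₁ i).mono hle₁).exists_trans ((p₂ i).mono hle₂)
  refine ⟨vs, es, p, fun i j hij e hi hj ↦ ?_⟩
  have hd' := Set.disjoint_left.1 hd
  rcases List.mem_append.1 (hs i hi) with hi | hi <;>
    rcases List.mem_append.1 (hs j hj) with hj | hj
  · exact d₁ hij hi hj
  · exact hd' ((p₁ i).edge_mem hi) ((p₂ j).edge_mem hj)
  · exact hd' ((p₁ j).edge_mem hj) ((p₂ i).edge_mem hi)
  · exact d₂ hij hi hj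

lemma HasEdgeDisjointPaths.add {k l : ℕ} {F₁ F₂ : Set β} (hF : Disjoint F₁ F₂)
    {vs₁ : Fin k → List α} {es₁ : Fin k → List β} {vs₂ : Fin l → List α} {es₂ : Fin l → List β}
    (p₁ : ∀ i, H.IsPath x y (vs₁ i) (es₁ i)) (p₂ : ∀ i, H.IsPath x y (vs₂ i) (es₂ i))
    (d₁ : Pairwise fun i j ↦ (es₁ i).Disjoint (es₁ j))
    (d₂ : Pairwise fun i j ↦ (es₂ i).Disjoint (es₂ j))
    (s₁ : ∀ i, ∀ e ∈ es₁ i, e ∈ F₁) (s₂ : ∀ i, ∀ e ∈ es₂ i, e ∈ F₂) :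
    H.HasEdgeDisjointPaths x y (k + l) := by
  have hF' := Set.disjoint_left.1 hF
  refine ⟨Fin.append vs₁ vs₂, Fin.append es₁ es₂, fun i ↦ ?_, fun i j ↦ ?_⟩
  · refine Fin.addCases (fun i ↦ ?_) (fun i ↦ ?_) i
    · simpa using p₁ i
    · simpa using p₂ i
  · refine Fin.addCases (fun i ↦ ?_) (fun i ↦ ?_) i <;>
      refine Fin.addCases (fun j ↦ ?_) (fun j ↦ ?_) j <;> intro hij <;>
      simp only [Fin.append_left, Fin.append_right]
    · exact d₁ fun h ↦ hij (by rw [h])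
    · exact fun e hi hj ↦ hF' (s₁ i e hi) (s₂ j e hj)
    · exact fun e hi hj ↦ hF' (s₁ j e hj) (s₂ i e hi)
    · exact d₂ fun h ↦ hij (by rw [h])

lemma HasEdgeDisjointPaths.union {k l : ℕ} (hle₁ : G₁ ≤ H) (hle₂ : G₂ ≤ H)
    (hd : Disjoint E(G₁) E(G₂)) (h₁ : G₁.HasEdgeDisjointPaths x y k)
    (h₂ : G₂.HasEdgeDisjointPaths x y l) : H.HasEdgeDisjointPaths x y (k + l) := by
  obtain ⟨vs₁, es₁, p₁, d₁⟩ := h₁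
  obtain ⟨vs₂, es₂, p₂, d₂⟩ := h₂
  exact add hd (fun i ↦ (p₁ i).mono hle₁) (fun i ↦ (p₂ i).mono hle₂) d₁ d₂
    (fun i _ ↦ (p₁ i).edge_mem) (fun i _ ↦ (p₂ i).edge_mem)

/-- The outside path is the extra unit of flow that turns maxmaxflow at most `Λ` into `k ≤ Λ - 1`.
-/
lemma HasEdgeDisjointPaths.succ_of_joinedOff {k : ℕ} (hle : G ≤ H)
    (h : G.HasEdgeDisjointPaths x y k) (hj : H.JoinedOff E(G) x y) :
    H.HasEdgeDisjointPaths x y (k + 1) := by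
  obtain ⟨vs, es, p, d⟩ := h
  obtain ⟨vs', es', p', d'⟩ := hj
  exact add (F₂ := E(G)ᶜ) disjoint_compl_right (fun i ↦ (p i).mono hle) (fun _ : Fin 1 ↦ p') d
    (fun i j hij ↦ (hij (Subsingleton.elim _ _)).elim) (fun i _ ↦ (p i).edge_mem) (fun _ ↦ d')

lemma IsPath.hasEdgeDisjointPaths_one (h : G.IsPath x y vs es) : G.HasEdgeDisjointPaths x y 1 :=
  ⟨fun _ ↦ vs, fun _ ↦ es, fun _ ↦ h, fun _ _ hij ↦ (hij (Subsingleton.elim _ _)).elim⟩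

lemma HasEdgeDisjointPaths.le_of_maxmaxflow_le {k Λ : ℕ} (hx : x ∈ V(G)) (hy : y ∈ V(G))
    (hxy : x ≠ y) (h : G.HasEdgeDisjointPaths x y k) (hΛ : G.maxmaxflow ≤ Λ) : k ≤ Λ := by
  have h₁ : (k : ℕ∞) ≤ G.maxFlow x y :=
    le_iSup₂_of_le (f := fun (k : ℕ) (_ : G.HasEdgeDisjointPaths x y k) ↦ (k : ℕ∞)) k h le_rfl
  have h₂ : G.maxFlow x y ≤ G.maxmaxflow :=
    le_iSup₂_of_le x hx (le_iSup₂_of_le y hy (le_iSup_of_le hxy le_rfl))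
  exact_mod_cast h₁.trans (h₂.trans hΛ)

/-! ### Graphs in the Wheatstone class -/

lemma IsEdgeDisjointUnion.left_le (h : H.IsEdgeDisjointUnion G₁ G₂) : G₁ ≤ H where
  vertexSet_mono := h.vertexSet_eq ▸ Set.subset_union_left
  isLink_mono e x y he := (h.isLink_iff e x y).2 (.inl he)

lemma IsEdgeDisjointUnion.right_le (h : H.IsEdgeDisjointUnion G₁ G₂) : G₂ ≤ H where
  vertexSet_mono := h.vertexSet_eq ▸ Set.subset_union_right
  isLink_mono e x y he := (h.isLink_iff e x y).2 (.inr he)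

lemma IsEdgeDisjointUnion.edgeSet_eq (h : H.IsEdgeDisjointUnion G₁ G₂) :
    E(H) = E(G₁) ∪ E(G₂) := by
  ext e
  simp only [Set.mem_union, edge_mem_iff_exists_isLink, h.isLink_iff, exists_or]

lemma IsWheatstoneBridge.hasEdgeDisjointPaths (h : G.IsWheatstoneBridge s t) :
    G.HasEdgeDisjointPaths s t 2 := by
  obtain ⟨a, b, e, hn, he, -, -, h0, h1, h2, h3, -⟩ := h
  simp only [List.nodup_cons, List.mem_cons, List.not_mem_nil, or_false, not_or] at hn
  have p₁ : G.IsPath s t [s, a, t] [e 0, e 2] :=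
    .cons h0 (by simp; tauto) (.cons h2 (by simp; tauto) (.nil h2.right_mem))
  have p₂ : G.IsPath s t [s, b, t] [e 1, e 3] :=
    .cons h1 (by simp; tauto) (.cons h3 (by simp; tauto) (.nil h3.right_mem))
  refine HasEdgeDisjointPaths.add (k := 1) (l := 1) (F₁ := {e 0, e 2}) (F₂ := {e 1, e 3}) ?_
    (fun _ ↦ p₁) (fun _ ↦ p₂) (fun i j hij ↦ (hij (Subsingleton.elim _ _)).elim)
    (fun i j hij ↦ (hij (Subsingleton.elim _ _)).elim) (by simp) (by simp)
  rw [Set.disjoint_left]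
  rintro _ (rfl | rfl) (h | h) <;> exact absurd (he h) (by decide)

lemma InWheatstoneClass.exists_isPath (h : G.InWheatstoneClass s t) :
    ∃ vs es, G.IsPath s t vs es := by
  induction h with
  | @edge s t e hst =>
    exact ⟨[s, t], [e], .cons (y := t) (by simp) (by simpa using hst) (.nil (by simp))⟩
  | bridge h =>
    obtain ⟨vs, es, p, -⟩ := h.hasEdgeDisjointPaths
    exact ⟨_, _, p 0⟩
  | series _ _ hH _ ih₁ ih₂ =>
    obtain ⟨_, _, p₁⟩ := ih₁
    obtain ⟨_, _, p₂⟩ := ih₂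
    obtain ⟨vs, es, p, -⟩ := (p₁.mono hH.left_le).exists_trans (p₂.mono hH.right_le)
    exact ⟨vs, es, p⟩
  | parallel _ _ hH _ ih₁ _ =>
    obtain ⟨vs, es, p⟩ := ih₁
    exact ⟨vs, es, p.mono hH.left_le⟩

lemma InWheatstoneClass.left_mem (h : G.InWheatstoneClass s t) : s ∈ V(G) :=
  let ⟨_, _, p⟩ := h.exists_isPath; p.left_mem

lemma InWheatstoneClass.right_mem (h : G.InWheatstoneClass s t) : t ∈ V(G) :=
  let ⟨_, _, p⟩ := h.exists_isPath; p.right_mem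

lemma InWheatstoneClass.ne (h : G.InWheatstoneClass s t) : s ≠ t := by
  induction h with
  | edge e hst => exact hst
  | bridge h => obtain ⟨a, b, e, hn, -⟩ := h; simp_all
  | @series H G₁ G₂ s m t h₁ h₂ hH hV ih₁ ih₂ =>
    rintro rfl
    have : s ∈ V(G₁) ∩ V(G₂) := ⟨h₁.left_mem, h₂.right_mem⟩
    rw [hV] at this
    exact ih₁ this
  | parallel _ _ _ _ ih₁ _ => exact ih₁

lemma InWheatstoneClass.finite_vertexSet (h : G.InWheatstoneClass s t) : V(G).Finite := by
  induction h with
  | edge e hst => simp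
  | bridge h => obtain ⟨a, b, e, -, -, hV, -⟩ := h; simp [hV]
  | series _ _ hH _ ih₁ ih₂ => rw [hH.vertexSet_eq]; exact ih₁.union ih₂
  | parallel _ _ hH _ ih₁ ih₂ => rw [hH.vertexSet_eq]; exact ih₁.union ih₂

lemma InWheatstoneClass.finite_edgeSet (h : G.InWheatstoneClass s t) : E(G).Finite := by
  induction h with
  | edge e hst => simp
  | bridge h => obtain ⟨a, b, e, -, -, -, hE, -⟩ := h; rw [hE]; exact Set.finite_range e
  | series _ _ hH _ ih₁ ih₂ => rw [hH.edgeSet_eq]; exact ih₁.union ih₂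
  | parallel _ _ hH _ ih₁ ih₂ => rw [hH.edgeSet_eq]; exact ih₁.union ih₂

end Graph

namespace Graph

variable {α β : Type*} {G H G₁ G₂ : Graph α β} {x y z s t m : α}

/-! ### Colourings -/

/-- The functions `V(G) → {0, …, n - 1}`, extended by `0` to all of `α`. -/
def boundedMaps (G : Graph α β) (n : ℕ) : Set (α → ℕ) :=
  {σ | (∀ x ∈ V(G), σ x < n) ∧ ∀ x ∉ V(G), σ x = 0}

/-- The proper colourings of `G` with colours `0, …, n - 1`, extended by `0` to all of `α`. -/
def colorings (G : Graph α β) (n : ℕ) : Set (α → ℕ) :=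
  {σ | σ ∈ G.boundedMaps n ∧ ∀ e x y, G.IsLink e x y → σ x ≠ σ y}

lemma finite_boundedMaps (hV : V(G).Finite) (n : ℕ) : (G.boundedMaps n).Finite := by
  have := hV.to_subtype
  refine Set.finite_coe_iff.1 <| Finite.of_injective
    (fun (σ : G.boundedMaps n) (x : V(G)) ↦ (⟨σ.1 x, σ.2.1 x x.2⟩ : Fin n)) fun σ τ h ↦ ?_
  ext x
  by_cases hx : x ∈ V(G)
  · simpa using congrFun h ⟨x, hx⟩
  · rw [σ.2.2 x hx, τ.2.2 x hx]

lemma finite_colorings (hV : V(G).Finite) (n : ℕ) : (G.colorings n).Finite :=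
  (finite_boundedMaps hV n).subset fun _ h ↦ h.1

/-- `n ^ k(G)` counts the `n`-valued functions that are constant along every edge. -/
lemma pow_numComponents (hV : V(G).Finite) (n : ℕ) :
    n ^ G.numComponents =
      {σ ∈ G.boundedMaps n | ∀ e x y, G.IsLink e x y → σ x = σ y}.ncard := by
  classical
  have := hV.to_subtype
  have : Finite G.toSimpleGraph.ConnectedComponent :=
    Finite.of_surjective _ Quot.mk_surjective
  rw [← Nat.card_coe_set_eq, numComponents]
  have h₁ : n ^ Nat.card G.toSimpleGraph.ConnectedComponent =
      Nat.card (G.toSimpleGraph.ConnectedComponent → Fin n) := by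
    rw [Nat.card_fun, Nat.card_fin]
  rw [h₁]
  let f : (G.toSimpleGraph.ConnectedComponent → Fin n) →
      {σ ∈ G.boundedMaps n | ∀ e x y, G.IsLink e x y → σ x = σ y} := fun φ ↦
    ⟨fun x ↦ if hx : x ∈ V(G) then φ (G.toSimpleGraph.connectedComponentMk ⟨x, hx⟩) else 0, by
      refine ⟨⟨fun x hx ↦ by simp [hx], fun x hx ↦ by simp [hx]⟩, fun e x y he ↦ ?_⟩
      simp only [he.left_mem, he.right_mem, dif_pos]
      by_cases hxy : x = y
      · subst hxy; rfl
      · have hadj : G.toSimpleGraph.Adj ⟨x, he.left_mem⟩ ⟨y, he.right_mem⟩ :=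
          ⟨fun h ↦ hxy (congrArg Subtype.val h), ⟨e, he⟩⟩
        rw [SimpleGraph.ConnectedComponent.sound hadj.reachable]⟩
  refine Nat.card_eq_of_bijective f ⟨fun φ ψ h ↦ ?_, fun σ ↦ ?_⟩
  · funext c
    induction c using SimpleGraph.ConnectedComponent.ind with
    | h v =>
      have := congrFun (congrArg Subtype.val h) v
      simpa [f, Fin.ext_iff] using this
  · obtain ⟨σ, ⟨hb, h0⟩, hσ⟩ := σ
    have hlift : ∀ (v w : V(G)) (_ : G.toSimpleGraph.Walk v w),
        (⟨σ v, hb v v.2⟩ : Fin n) = ⟨σ w, hb w w.2⟩ := by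
      intro v w p
      induction p with
      | nil => rfl
      | cons hadj p ih =>
        obtain ⟨-, e, he⟩ := hadj
        rw [← ih]
        simpa using hσ e _ _ he
    refine ⟨fun c ↦ c.lift (fun v : V(G) ↦ (⟨σ v, hb v v.2⟩ : Fin n))
      fun v w p _ ↦ hlift v w p, Subtype.ext (funext fun x ↦ ?_)⟩
    by_cases hx : x ∈ V(G)
    · simp [f, hx]
    · simp [f, hx, h0 x hx]

/-- The chromatic polynomial counts proper colourings. -/
lemma eval_chromaticPolynomial (hV : V(G).Finite) (hE : E(G).Finite) (n : ℕ) :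
    G.chromaticPolynomial.eval (n : ℤ) = (G.colorings n).ncard := by
  classical
  have hF := finite_boundedMaps hV n
  let M : β → (α → ℕ) → Prop := fun e σ ↦ ∃ x y, G.IsLink e x y ∧ σ x = σ y
  have hsum : G.chromaticPolynomial = ∑ A ∈ hE.toFinset.powerset,
      Polynomial.C (∏ e ∈ A, (-1 : ℤ)) *
        Polynomial.X ^ (G.restrict (A : Set β)).numComponents := by
    rw [chromaticPolynomial, multivariateTutte]
    rw [← finsum_mem_coe_finset]
    refine finsum_congr fun A ↦ ?_
    have hA : ((A : Set β) ⊆ E(G)) = (A ∈ (hE.toFinset.powerset : Set (Finset β))) := by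
      simp
    rw [hA]
  have hpow : ∀ A ∈ hE.toFinset.powerset,
      ((n : ℤ) ^ (G.restrict (A : Set β)).numComponents) =
        ∑ σ ∈ hF.toFinset, ∏ e ∈ A, if M e σ then (1 : ℤ) else 0 := by
    intro A hA
    have hA' : ∀ e ∈ A, e ∈ E(G) := fun e he ↦ by
      simpa using Finset.mem_powerset.1 hA he
    have := pow_numComponents (G := G.restrict (A : Set β)) (by simpa using hV) n
    rw [← Nat.cast_pow, this]
    simp only [Finset.prod_ite_zero, Finset.prod_const_one]
    rw [Finset.sum_boole]
    congr 1
    rw [← Set.ncard_coe_finset]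
    congr 1
    ext σ
    simp only [Finset.coe_filter, Set.Finite.mem_toFinset, Set.mem_ofPred_eq, boundedMaps,
      vertexSet_restrict, restrict_isLink]
    refine and_congr_right fun _ ↦ ⟨fun h e he ↦ ?_, fun h e x y he ↦ ?_⟩
    · obtain ⟨x, y, hl⟩ := exists_isLink_of_mem_edgeSet (hA' e he)
      exact ⟨x, y, hl, h e x y (by simp_all)⟩
    · obtain ⟨x', y', hl, hσ⟩ := h e (by simp_all)
      have hl' : G.IsLink e x y := by simp_all
      rcases hl.eq_and_eq_or_eq_and_eq hl' with ⟨rfl, rfl⟩ | ⟨rfl, rfl⟩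
      exacts [hσ, hσ.symm]
  rw [hsum, Polynomial.eval_finsetSum]
  simp only [Polynomial.eval_mul, Polynomial.eval_C, Polynomial.eval_pow, Polynomial.eval_X]
  rw [Finset.sum_congr rfl fun A hA ↦ by rw [hpow A hA, Finset.mul_sum]]
  -- Inclusion-exclusion in reverse: for a fixed `σ`, the signed sum over `A` is the expansion of
  -- the product over all edges of `1 - [e is monochromatic]`, which is `1` or `0` according to
  -- whether `σ` is proper.
  simp only [← Finset.prod_mul_distrib]
  rw [Finset.sum_comm]
  simp only [← Finset.prod_one_add]
  have : ∀ σ ∈ hF.toFinset, (∏ e ∈ hE.toFinset, (1 + -1 * if M e σ then (1 : ℤ) else 0)) =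
      if σ ∈ G.colorings n then 1 else 0 := by
    intro σ hσ
    have : ∀ e, (1 + -1 * if M e σ then (1 : ℤ) else 0) = if ¬ M e σ then 1 else 0 := by
      intro e; split_ifs <;> simp_all
    simp only [this, Finset.prod_ite_zero, Finset.prod_const_one]
    congr 1
    simp only [Set.Finite.mem_toFinset, eq_iff_iff, colorings, Set.mem_ofPred_eq, M, not_exists,
      not_and]
    exact ⟨fun h ↦ ⟨by simpa using hσ, fun e x y hl ↦ h e hl.edge_mem x y hl⟩,
      fun h e _ x y hl ↦ h.2 e x y hl⟩
  rw [Finset.sum_congr rfl this, Finset.sum_boole, ← Set.ncard_coe_finset]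
  congr 2
  ext σ
  simp only [Finset.coe_filter, Set.Finite.mem_toFinset, Set.mem_ofPred_eq]
  exact ⟨fun h ↦ h.2, fun h ↦ ⟨h.1, h⟩⟩

/-- Colourings of an edge-disjoint union whose restrictions lie in two families agreeing on the
common vertices are pairs of such restrictions. -/
lemma IsEdgeDisjointUnion.ncard_glue (hH : H.IsEdgeDisjointUnion G₁ G₂) {n : ℕ}
    {T₁ T₂ : Set (α → ℕ)} (h₁ : T₁ ⊆ G₁.colorings n) (h₂ : T₂ ⊆ G₂.colorings n)
    (hagree : ∀ σ ∈ T₁, ∀ τ ∈ T₂, ∀ x ∈ V(G₁) ∩ V(G₂), σ x = τ x) :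
    {σ ∈ H.colorings n | V(G₁).indicator σ ∈ T₁ ∧ V(G₂).indicator σ ∈ T₂}.ncard =
      T₁.ncard * T₂.ncard := by
  classical
  rw [← Set.ncard_prod]
  have hr₁ : ∀ σ ∈ T₁, ∀ τ ∈ T₂,
      V(G₁).indicator (fun x ↦ if x ∈ V(G₁) then σ x else τ x) = σ := fun σ hσ τ hτ ↦ by
    funext x
    by_cases hx : x ∈ V(G₁)
    · simp [hx]
    · simp [hx, (h₁ hσ).1.2 x hx]
  have hr₂ : ∀ σ ∈ T₁, ∀ τ ∈ T₂,
      V(G₂).indicator (fun x ↦ if x ∈ V(G₁) then σ x else τ x) = τ := fun σ hσ τ hτ ↦ by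
    funext x
    by_cases hx : x ∈ V(G₂)
    · by_cases hx' : x ∈ V(G₁)
      · simp [hx, hx', hagree σ hσ τ hτ x ⟨hx', hx⟩]
      · simp [hx, hx']
    · simp [hx, (h₂ hτ).1.2 x hx]
  refine Set.ncard_congr (fun σ _ ↦ (V(G₁).indicator σ, V(G₂).indicator σ))
    (fun σ hσ ↦ ⟨hσ.2.1, hσ.2.2⟩) (fun σ τ hσ hτ h ↦ ?_) fun p hp ↦ ?_
  · rw [Prod.ext_iff] at h
    funext x
    by_cases hx₁ : x ∈ V(G₁)
    · simpa [hx₁] using congrFun h.1 x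
    by_cases hx₂ : x ∈ V(G₂)
    · simpa [hx₂] using congrFun h.2 x
    have hx : x ∉ V(H) := by simp [hH.vertexSet_eq, hx₁, hx₂]
    rw [hσ.1.1.2 x hx, hτ.1.1.2 x hx]
  · obtain ⟨σ, τ⟩ := p
    obtain ⟨hσ, hτ⟩ : σ ∈ T₁ ∧ τ ∈ T₂ := hp
    have e₁ := hr₁ σ hσ τ hτ
    have e₂ := hr₂ σ hσ τ hτ
    set ρ : α → ℕ := fun x ↦ if x ∈ V(G₁) then σ x else τ x
    have v₁ : ∀ x ∈ V(G₁), ρ x = σ x := fun x hx ↦ by rw [← e₁]; simp [hx]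
    have v₂ : ∀ x ∈ V(G₂), ρ x = τ x := fun x hx ↦ by rw [← e₂]; simp [hx]
    refine ⟨ρ, ⟨⟨⟨fun x hx ↦ ?_, fun x hx ↦ ?_⟩, fun e x y he ↦ ?_⟩, ?_, ?_⟩, ?_⟩
    · rw [hH.vertexSet_eq] at hx
      rcases hx with hx | hx
      · rw [v₁ x hx]; exact (h₁ hσ).1.1 x hx
      · rw [v₂ x hx]; exact (h₂ hτ).1.1 x hx
    · rw [hH.vertexSet_eq, Set.mem_union, not_or] at hx
      simp [ρ, hx.1, (h₂ hτ).1.2 x hx.2]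
    · rcases (hH.isLink_iff e x y).1 he with he | he
      · rw [v₁ x he.left_mem, v₁ y he.right_mem]; exact (h₁ hσ).2 e x y he
      · rw [v₂ x he.left_mem, v₂ y he.right_mem]; exact (h₂ hτ).2 e x y he
    · rw [e₁]; exact hσ
    · rw [e₂]; exact hτ
    · rw [e₁, e₂]

lemma colorings.indicator_mem {n : ℕ} {σ : α → ℕ} (hle : G ≤ H) (hσ : σ ∈ H.colorings n) :
    V(G).indicator σ ∈ G.colorings n := by
  refine ⟨⟨fun x hx ↦ ?_, fun x hx ↦ by simp [hx]⟩, fun e x y he ↦ ?_⟩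
  · simpa [hx] using hσ.1.1 x (hle.vertexSet_mono hx)
  · simpa [he.left_mem, he.right_mem] using hσ.2 e x y (he.mono hle)

/-! ### Colourings with prescribed terminal colours -/

/-- The proper colourings of `G` in which `s` and `t` receive the colours `c` and `d`. -/
def terminalColorings (G : Graph α β) (s t : α) (n c d : ℕ) : Set (α → ℕ) :=
  {σ ∈ G.colorings n | σ s = c ∧ σ t = d}

/-- The number of `n`-colourings of `G` with colours `c` and `d` at the terminals is `A(n)` if
`c ≠ d`, and `A(n) + B(n)` if `c = d`. -/
def IsTerminalCount (G : Graph α β) (s t : α) (A B : ℤ[X]) : Prop :=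
  ∀ n c d : ℕ, c < n → d < n →
    ((G.terminalColorings s t n c d).ncard : ℤ) = A.eval (n : ℤ) + if c = d then B.eval (n : ℤ) else 0

/-- Of the `n ^ 2` pairs of terminal colours, `n` are diagonal, giving `n ^ 2 A(n) + n B(n)`
colourings. Agreement at all natural numbers forces equality of polynomials. -/
lemma IsTerminalCount.chromaticPolynomial_eq {A B : ℤ[X]} (h : G.IsTerminalCount s t A B)
    (hs : s ∈ V(G)) (ht : t ∈ V(G)) (hV : V(G).Finite) (hE : E(G).Finite) :
    G.chromaticPolynomial = .X * (.X * A + B) := by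
  classical
  refine Polynomial.eq_of_infinite_eval_eq _ _
    ((Set.infinite_range_of_injective (Nat.cast_injective (R := ℤ))).mono ?_)
  rintro _ ⟨n, rfl⟩
  rw [Set.mem_ofPred_eq, eval_chromaticPolynomial hV hE]
  have hF := finite_colorings hV n
  rw [Set.ncard_eq_toFinset_card _ hF]
  rw [Finset.card_eq_sum_card_fiberwise (f := fun σ ↦ (σ s, σ t))
    (t := Finset.range n ×ˢ Finset.range n) fun σ hσ ↦ by
      have hσ : σ ∈ G.colorings n := by simpa using hσ
      simpa using ⟨hσ.1.1 s hs, hσ.1.1 t ht⟩]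
  rw [Finset.sum_product]
  have : ∀ c ∈ Finset.range n, ∀ d ∈ Finset.range n,
      ((hF.toFinset.filter fun σ ↦ (σ s, σ t) = (c, d)).card : ℤ) =
        A.eval (n : ℤ) + if c = d then B.eval (n : ℤ) else 0 := by
    intro c hc d hd
    rw [← h n c d (Finset.mem_range.1 hc) (Finset.mem_range.1 hd), ← Set.ncard_coe_finset]
    congr 2
    ext σ
    simp [terminalColorings]
  push_cast
  rw [Finset.sum_congr rfl fun c hc ↦ Finset.sum_congr rfl (this c hc)]
  simp only [Finset.sum_add_distrib, Finset.sum_const, Finset.card_range, Finset.sum_ite_eq,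
    Finset.mem_range, Polynomial.eval_mul, Polynomial.eval_add, Polynomial.eval_X, nsmul_eq_mul]
  rw [Finset.sum_congr rfl fun c hc ↦ if_pos (Finset.mem_range.1 hc)]
  simp
  ring

lemma isTerminalCount_edge (e : β) (hst : s ≠ t) :
    IsTerminalCount (banana s t {e}) s t 1 (-1) := by
  classical
  intro n c d hc hd
  split_ifs with hcd
  · have : terminalColorings (banana s t {e}) s t n c d = ∅ := by
      refine Set.eq_empty_of_forall_notMem fun σ hσ ↦ ?_
      exact hσ.1.2 e s t (by simp) (by rw [hσ.2.1, hσ.2.2, hcd])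
    simp [this]
  · have : terminalColorings (banana s t {e}) s t n c d =
        {fun x ↦ if x = s then c else if x = t then d else 0} := by
      ext σ
      simp only [terminalColorings, colorings, boundedMaps, banana_isLink, vertexSet_banana,
        Set.mem_ofPred_eq, Set.mem_singleton_iff]
      constructor
      · rintro ⟨⟨⟨-, h0⟩, -⟩, h1, h2⟩
        funext x
        split_ifs with hx hx'
        · rw [hx, h1]
        · rw [hx', h2]
        · exact h0 x (by simp [hx, hx'])
      · rintro rfl
        refine ⟨⟨⟨?_, ?_⟩, ?_⟩, ?_, ?_⟩
        · rintro x (rfl | rfl)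
          · simpa
          · simpa [hst.symm]
        · intro x hx
          simp_all
        · rintro f x y ⟨-, ⟨rfl, rfl⟩ | ⟨rfl, rfl⟩⟩
          · simpa [hst.symm]
          · simpa [hst.symm] using Ne.symm hcd
        · simp
        · simp [hst.symm]
    simp [this]

lemma IsTerminalCount.parallel {A₁ B₁ A₂ B₂ : ℤ[X]} (hH : H.IsEdgeDisjointUnion G₁ G₂)
    (hV : V(G₁) ∩ V(G₂) = {s, t}) (h₁ : G₁.IsTerminalCount s t A₁ B₁)
    (h₂ : G₂.IsTerminalCount s t A₂ B₂) :
    H.IsTerminalCount s t (A₁ * A₂) ((A₁ + B₁) * (A₂ + B₂) - A₁ * A₂) := by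
  intro n c d hc hd
  have hs : s ∈ V(G₁) ∩ V(G₂) := by simp [hV]
  have ht : t ∈ V(G₁) ∩ V(G₂) := by simp [hV]
  have := hH.ncard_glue (n := n) (T₁ := G₁.terminalColorings s t n c d)
    (T₂ := G₂.terminalColorings s t n c d) (fun _ h ↦ h.1) (fun _ h ↦ h.1) (by
      rw [hV]
      rintro σ ⟨-, hσ⟩ τ ⟨-, hτ⟩ x (rfl | rfl)
      · rw [hσ.1, hτ.1]
      · rw [hσ.2, hτ.2])
  have heq : H.terminalColorings s t n c d = {σ ∈ H.colorings n |
      V(G₁).indicator σ ∈ G₁.terminalColorings s t n c d ∧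
      V(G₂).indicator σ ∈ G₂.terminalColorings s t n c d} := by
    ext σ
    refine and_congr_right fun hσ ↦ ?_
    simp [terminalColorings, colorings.indicator_mem hH.left_le hσ,
      colorings.indicator_mem hH.right_le hσ, hs.1, hs.2, ht.1, ht.2]
  rw [heq, this, Nat.cast_mul, h₁ n c d hc hd, h₂ n c d hc hd]
  split_ifs <;> simp

/-- Sum over the colour `x` of `m` the product `(A₁ + [c = x] B₁) (A₂ + [x = d] B₂)`. -/
lemma IsTerminalCount.series {A₁ B₁ A₂ B₂ : ℤ[X]} (hH : H.IsEdgeDisjointUnion G₁ G₂)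
    (hV : V(G₁) ∩ V(G₂) = {m}) (hfin : V(H).Finite) (hs : s ∈ V(G₁)) (ht : t ∈ V(G₂))
    (h₁ : G₁.IsTerminalCount s m A₁ B₁) (h₂ : G₂.IsTerminalCount m t A₂ B₂) :
    H.IsTerminalCount s t (.X * (A₁ * A₂) + A₁ * B₂ + B₁ * A₂) (B₁ * B₂) := by
  classical
  intro n c d hc hd
  have hm : m ∈ V(G₁) ∩ V(G₂) := by simp [hV]
  have hF : (H.terminalColorings s t n c d).Finite :=
    (finite_colorings hfin n).subset fun _ h ↦ h.1
  have hfib : ∀ x ∈ Finset.range n, ((hF.toFinset.filter fun σ ↦ σ m = x).card : ℤ) =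
      (A₁.eval (n : ℤ) + if c = x then B₁.eval (n : ℤ) else 0) *
        (A₂.eval (n : ℤ) + if x = d then B₂.eval (n : ℤ) else 0) := by
    intro x hx
    have hx := Finset.mem_range.1 hx
    rw [← h₁ n c x hc hx, ← h₂ n x d hx hd, ← Nat.cast_mul, ← Set.ncard_coe_finset]
    rw [← hH.ncard_glue (n := n) (fun _ h ↦ h.1) (fun _ h ↦ h.1) (by
      rw [hV]
      rintro σ ⟨-, hσ⟩ τ ⟨-, hτ⟩ x rfl
      rw [hσ.2, hτ.1])]
    congr 2
    ext σ
    simp only [Finset.coe_filter, Set.Finite.mem_toFinset, Set.mem_ofPred_eq, terminalColorings,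
      and_assoc]
    refine and_congr_right fun hσ ↦ ?_
    simp only [colorings.indicator_mem hH.left_le hσ, colorings.indicator_mem hH.right_le hσ, hs,
      ht, hm.1, hm.2, Set.indicator_of_mem, true_and]
    tauto
  rw [Set.ncard_eq_toFinset_card _ hF, Finset.card_eq_sum_card_fiberwise (f := fun σ ↦ σ m)
    (t := Finset.range n) fun σ hσ ↦ by
      have hσ : σ ∈ H.terminalColorings s t n c d := by simpa using hσ
      simpa using hσ.1.1.1 m (hH.left_le.vertexSet_mono hm.1)]
  push_cast
  rw [Finset.sum_congr rfl hfib]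
  have : ∀ x, (A₁.eval (n : ℤ) + if c = x then B₁.eval (n : ℤ) else 0) *
        (A₂.eval (n : ℤ) + if x = d then B₂.eval (n : ℤ) else 0) =
      A₁.eval (n : ℤ) * A₂.eval (n : ℤ) +
      (if c = x then B₁.eval (n : ℤ) * A₂.eval (n : ℤ) else 0) +
      (if d = x then A₁.eval (n : ℤ) * B₂.eval (n : ℤ) else 0) +
      (if c = x then if c = d then B₁.eval (n : ℤ) * B₂.eval (n : ℤ) else 0 else 0) := by
    intro x
    by_cases h : c = x
    · subst h
      by_cases h' : c = d
      · subst h'; simp; ring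
      · simp [h', Ne.symm h']; ring
    · by_cases h' : x = d
      · subst h'; simp [h]; ring
      · simp [h, h', Ne.symm h']
  simp only [this, Finset.sum_add_distrib, Finset.sum_const, Finset.card_range, Finset.sum_ite_eq,
    Finset.mem_range, hc, hd, if_true, nsmul_eq_mul]
  simp
  ring

/-- The inner vertices receive an ordered pair of distinct colours outside `{c, d}`: `(n - 2) (n -
3)` choices if `c ≠ d` and `(n - 1) (n - 2)` if `c = d`. -/
lemma IsWheatstoneBridge.isTerminalCount (h : G.IsWheatstoneBridge s t) :
    G.IsTerminalCount s t ((.X - 2) * (.X - 3)) (2 * (.X - 2)) := by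
  classical
  obtain ⟨a, b, e, hn, he, hV, hE, h0, h1, h2, h3, h4⟩ := h
  simp only [List.nodup_cons, List.mem_cons, List.not_mem_nil, or_false, not_or,
    not_false_eq_true, List.nodup_nil, and_true] at hn
  obtain ⟨⟨hsa, hsb, hst⟩, ⟨hab, hat⟩, hbt⟩ := hn
  intro n c d hc hd
  set C : Finset ℕ := Finset.range n \ {c, d} with hC
  have hlink : ∀ σ : α → ℕ, (∀ f x y, G.IsLink f x y → σ x ≠ σ y) ↔
      σ s ≠ σ a ∧ σ s ≠ σ b ∧ σ a ≠ σ t ∧ σ b ≠ σ t ∧ σ a ≠ σ b := by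
    intro σ
    refine ⟨fun h ↦ ⟨h _ _ _ h0, h _ _ _ h1, h _ _ _ h2, h _ _ _ h3, h _ _ _ h4⟩, ?_⟩
    rintro ⟨g0, g1, g2, g3, g4⟩ f x y hf
    have key : ∀ u v, G.IsLink f u v → σ u ≠ σ v → σ x ≠ σ y := by
      intro u v huv hσ
      rcases huv.eq_and_eq_or_eq_and_eq hf with ⟨rfl, rfl⟩ | ⟨rfl, rfl⟩
      exacts [hσ, hσ.symm]
    have hfE : f ∈ Set.range e := hE ▸ hf.edge_mem
    obtain ⟨i, rfl⟩ := hfE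
    fin_cases i
    exacts [key _ _ h0 g0, key _ _ h1 g1, key _ _ h2 g2, key _ _ h3 g3, key _ _ h4 g4]
  have hcard : (G.terminalColorings s t n c d).ncard = C.offDiag.card := by
    rw [← Set.ncard_coe_finset]
    refine Set.ncard_congr (fun σ _ ↦ (σ a, σ b)) (fun σ hσ ↦ ?_) (fun σ τ hσ hτ h ↦ ?_)
      fun p hp ↦ ?_
    · obtain ⟨⟨⟨hb, -⟩, hl⟩, rfl, rfl⟩ := hσ
      rw [hlink] at hl
      obtain ⟨g0, g1, g2, g3, g4⟩ := hl
      simp [hC, hb a (by simp [hV]), hb b (by simp [hV]), g0.symm, g1.symm, g2, g3, g4]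
    · obtain ⟨⟨⟨-, h0⟩, -⟩, hs, ht⟩ := hσ
      obtain ⟨⟨⟨-, h0'⟩, -⟩, hs', ht'⟩ := hτ
      rw [Prod.ext_iff] at h
      funext x
      by_cases hx : x ∈ V(G)
      · rw [hV] at hx
        rcases hx with rfl | rfl | rfl | rfl
        exacts [hs.trans hs'.symm, h.1, h.2, ht.trans ht'.symm]
      · rw [h0 x hx, h0' x hx]
    · obtain ⟨x, y⟩ := p
      simp only [hC, Finset.coe_offDiag, Set.mem_offDiag, Finset.mem_coe, Finset.mem_sdiff,
        Finset.mem_range, Finset.mem_insert, Finset.mem_singleton, not_or] at hp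
      obtain ⟨⟨hx, hxc, hxd⟩, ⟨hy, hyc, hyd⟩, hxy⟩ := hp
      refine ⟨fun z ↦ if z = s then c else if z = a then x else if z = b then y else
        if z = t then d else 0, ⟨⟨⟨fun z hz ↦ ?_, fun z hz ↦ ?_⟩, ?_⟩, ?_, ?_⟩, ?_⟩
      · dsimp only
        split_ifs <;> omega
      · simp_all
      · rw [hlink]
        simp [Ne.symm hsa, Ne.symm hsb, Ne.symm hst, Ne.symm hab, Ne.symm hat, Ne.symm hbt]
        tauto
      · simp
      · simp [Ne.symm hst, Ne.symm hat, Ne.symm hbt]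
      · simp [Ne.symm hsa, Ne.symm hsb, Ne.symm hab]
  rw [hcard, Finset.offDiag_card]
  have hsub : ({c, d} : Finset ℕ) ⊆ Finset.range n := by
    intro z hz
    simp at hz
    rcases hz with rfl | rfl <;> simpa
  have hCn : (C.card : ℤ) = n - (({c, d} : Finset ℕ).card : ℤ) := by
    rw [hC, Finset.card_sdiff_of_subset hsub, Nat.cast_sub (Finset.card_le_card hsub),
      Finset.card_range]
  rw [Nat.cast_sub (Nat.le_mul_self _), Nat.cast_mul, hCn]
  split_ifs with hcd
  · subst hcd
    simp
    ring
  · rw [Finset.card_pair hcd]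
    simp
    ring

end Graph

/-! ### Regions of transmissivities -/

/-- The region of transmissivities of 2-terminal graphs admitting `k` edge-disjoint paths between
the terminals: the transmissivity `-1 / Q` of a single edge, together with a disc. -/
def InTransmissivityRegion (Q : ℂ) (Y : ℝ) (k : ℕ) (t : ℂ) : Prop :=
  Q * t = -1 ∨ ‖Q‖⁻¹ + ‖t‖ ≤ ‖Q‖⁻¹ * Y ^ k * (1 + ‖t‖)

namespace InTransmissivityRegion

variable {Q t t₁ t₂ : ℂ} {Y : ℝ} {k l : ℕ}

/-- The bound on `Y ^ k` says precisely that the disc has radius at most `‖Q‖⁻¹`; a single edge has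
norm equal to it. -/
lemma norm_le (hQ : 1 < ‖Q‖) (hk : Y ^ k * (1 + ‖Q‖⁻¹) ≤ 2)
    (h : InTransmissivityRegion Q Y k t) : ‖t‖ ≤ ‖Q‖⁻¹ := by
  have hQ0 : 0 < ‖Q‖ := by linarith
  rcases h with h | h
  · have := congrArg norm h
    rw [norm_mul, norm_neg, norm_one] at this
    exact (eq_inv_of_mul_eq_one_right this).le
  · set ρ := ‖Q‖⁻¹
    have h0 : 0 < ρ := by positivity
    have h1 : ρ < 1 := inv_lt_one_of_one_lt₀ hQ
    have h2 : (ρ + ‖t‖) * (1 + ρ) ≤ ρ * 2 * (1 + ‖t‖) := by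
      calc (ρ + ‖t‖) * (1 + ρ) ≤ ρ * Y ^ k * (1 + ‖t‖) * (1 + ρ) := by gcongr
        _ = ρ * (Y ^ k * (1 + ρ)) * (1 + ‖t‖) := by ring
        _ ≤ _ := by gcongr
    nlinarith [norm_nonneg t]

/-- This gives the inequality defining the disc the right direction: it persists when `‖t‖`
decreases. -/
lemma inv_mul_pow_le_one (hQ : 1 < ‖Q‖) (hk : Y ^ k * (1 + ‖Q‖⁻¹) ≤ 2) :
    ‖Q‖⁻¹ * Y ^ k ≤ 1 := by
  set ρ := ‖Q‖⁻¹
  have h0 : 0 < ρ := by simp only [ρ]; positivity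
  have h1 : ρ < 1 := inv_lt_one_of_one_lt₀ hQ
  nlinarith

/-- Multiplication by `t₂` shrinks the disc into itself. If `t₁` is the single-edge point, the
product has norm at most `‖Q‖⁻¹ ^ 2`, and `hY1` puts that already in the disc for `k = 1`. -/
lemma series (hQ : 1 < ‖Q‖) (hY : 1 ≤ Y) (hY1 : 1 + ‖Q‖⁻¹ ≤ Y * (1 + ‖Q‖⁻¹ ^ 2)) (hk0 : 1 ≤ k)
    (hk : Y ^ k * (1 + ‖Q‖⁻¹) ≤ 2) (h : InTransmissivityRegion Q Y k t₁) (ht : ‖t₂‖ ≤ ‖Q‖⁻¹) :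
    InTransmissivityRegion Q Y k (t₁ * t₂) := by
  right
  have hQ0 : 0 < ‖Q‖ := by linarith
  have hle := inv_mul_pow_le_one hQ hk
  have hnorm := h.norm_le hQ hk
  have h1 : ‖Q‖⁻¹ < 1 := inv_lt_one_of_one_lt₀ hQ
  rw [norm_mul]
  rcases h with h | h
  · set ρ := ‖Q‖⁻¹
    have h0 : 0 < ρ := by positivity
    have hx : ‖t₁‖ * ‖t₂‖ ≤ ρ ^ 2 := by
      rw [sq]; exact mul_le_mul hnorm ht (norm_nonneg _) h0.le
    have hYk : Y ≤ Y ^ k := le_self_pow₀ hY (by omega)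
    have : 1 + ρ ≤ Y ^ k * (1 + ρ ^ 2) := hY1.trans (by gcongr)
    nlinarith
  · have hx : ‖t₁‖ * ‖t₂‖ ≤ ‖t₁‖ :=
      mul_le_of_le_one_right (norm_nonneg _) (ht.trans h1.le)
    nlinarith

lemma one_add_mul_ne_zero (hQ : 1 < ‖Q‖) (h₁ : ‖t₁‖ ≤ ‖Q‖⁻¹) (h₂ : ‖t₂‖ ≤ ‖Q‖⁻¹) :
    1 + Q * t₁ * t₂ ≠ 0 := by
  intro h
  have hQ0 : 0 < ‖Q‖ := by linarith
  have h' : Q * t₁ * t₂ = -1 := by linear_combination h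
  have := congrArg norm h'
  rw [norm_mul, norm_mul, norm_neg, norm_one] at this
  have h3 : ‖Q‖ * ‖t₁‖ * ‖t₂‖ ≤ ‖Q‖ * ‖Q‖⁻¹ * ‖Q‖⁻¹ := by gcongr
  rw [mul_inv_cancel₀ hQ0.ne', one_mul, this] at h3
  exact absurd h3 (not_le.2 (inv_lt_one_of_one_lt₀ hQ))

/-- By the triangle inequality the worst case is `Q`, `t₁`, `t₂` all negative reals. There `(1 + Q
t) / (1 - t)` becomes `(1 + ‖Q‖ ‖t‖) / (1 + ‖t‖)`, so multiplicativity multiplies the bounds `Y ^ k`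
and `Y ^ l`. -/
lemma parallel (hQ : 1 < ‖Q‖) (hY : 1 ≤ Y) (hkl : Y ^ (k + l) * (1 + ‖Q‖⁻¹) ≤ 2)
    (h₁ : InTransmissivityRegion Q Y k t₁) (h₂ : InTransmissivityRegion Q Y l t₂)
    (ht : t * (1 + Q * t₁ * t₂) = t₁ + t₂ + (Q - 1) * t₁ * t₂) :
    InTransmissivityRegion Q Y (k + l) t := by
  have hQ0 : 0 < ‖Q‖ := by linarith
  have hρ : ‖Q‖⁻¹ < 1 := inv_lt_one_of_one_lt₀ hQ
  have hn₁ := h₁.norm_le hQ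
    (le_trans (by gcongr 1; exact pow_le_pow_right₀ hY (by omega)) hkl)
  have hn₂ := h₂.norm_le hQ
    (le_trans (by gcongr 1; exact pow_le_pow_right₀ hY (by omega)) hkl)
  have hne := one_add_mul_ne_zero hQ hn₁ hn₂
  -- The value `-1 / Q` is absorbing, since `1 + Q t` is `(1 + Q t₁) (1 + Q t₂)` up to a nonzero
  -- factor.
  have key : Q * t₁ = -1 ∨ Q * t₂ = -1 → Q * t = -1 := by
    intro h
    have : (Q * t + 1) * (1 + Q * t₁ * t₂) = 0 := by
      have : (Q * t + 1) * (1 + Q * t₁ * t₂) = (1 + Q * t₁) * (1 + Q * t₂) := by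
        linear_combination Q * ht
      rw [this]
      rcases h with h | h <;> simp [h]
    exact eq_neg_of_add_eq_zero_left ((mul_eq_zero.1 this).resolve_right hne)
  rcases h₁ with h₁ | h₁
  · exact .inl (key (.inl h₁))
  rcases h₂ with h₂ | h₂
  · exact .inl (key (.inr h₂))
  right
  have hle := inv_mul_pow_le_one hQ hkl
  have hM : 1 - ‖Q‖ * ‖t₁‖ * ‖t₂‖ ≤ ‖1 + Q * t₁ * t₂‖ := by
    have := norm_sub_norm_le (1 : ℂ) (-(Q * t₁ * t₂))
    simpa using this
  have hN : ‖t‖ * ‖1 + Q * t₁ * t₂‖ ≤ ‖t₁‖ + ‖t₂‖ + (‖Q‖ + 1) * ‖t₁‖ * ‖t₂‖ := by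
    rw [← norm_mul, ht]
    refine (norm_add₃_le).trans ?_
    rw [norm_mul, norm_mul]
    gcongr
    simpa using norm_sub_le Q 1
  have hM0 : 0 < ‖1 + Q * t₁ * t₂‖ := norm_pos_iff.2 hne
  set ρ := ‖Q‖⁻¹ with hρd
  have h0 : 0 < ρ := by positivity
  have hQρ : ‖Q‖ * ρ = 1 := mul_inv_cancel₀ hQ0.ne'
  set M := ‖1 + Q * t₁ * t₂‖
  set a := ‖t₁‖ with ha
  set b := ‖t₂‖ with hb
  have ha0 : 0 ≤ a := norm_nonneg _
  have hb0 : 0 ≤ b := norm_nonneg _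
  have hprod : (ρ + a) * (ρ + b) ≤ (ρ * Y ^ k * (1 + a)) * (ρ * Y ^ l * (1 + b)) := by
    gcongr
  have hYkl : (1 : ℝ) ≤ Y ^ (k + l) := one_le_pow₀ hY
  rw [pow_add] at hle hYkl ⊢
  set Z := Y ^ k * Y ^ l with hZ
  have hp : (ρ + a) * (ρ + b) ≤ ρ ^ 2 * Z * ((1 + a) * (1 + b)) := by
    rw [hZ]; linarith
  have hmain : (ρ + a) * (1 + ‖Q‖ * b) ≤ ρ * Z * ((1 + a) * (1 + b)) := by
    have : (ρ + a) * (1 + ‖Q‖ * b) = ‖Q‖ * ((ρ + a) * (ρ + b)) := by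
      linear_combination (-(ρ + a)) * hQρ
    rw [this]
    calc ‖Q‖ * ((ρ + a) * (ρ + b)) ≤ ‖Q‖ * (ρ ^ 2 * Z * ((1 + a) * (1 + b))) := by gcongr
      _ = ‖Q‖ * ρ * (ρ * Z * ((1 + a) * (1 + b))) := by ring
      _ = _ := by rw [hQρ, one_mul]
  have hfin : ‖t‖ * M * (1 - ρ * Z) ≤ ρ * (Z - 1) * M := by
    calc ‖t‖ * M * (1 - ρ * Z) ≤ (a + b + (‖Q‖ + 1) * a * b) * (1 - ρ * Z) :=
          mul_le_mul_of_nonneg_right hN (by linarith)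
      -- This is `hmain` rearranged.
      _ ≤ ρ * (Z - 1) * (1 - ‖Q‖ * a * b) := by
          have e : ρ * ‖Q‖ * b = b := by rw [mul_comm ρ, hQρ, one_mul]
          have e' : ρ * ‖Q‖ * a * b = a * b := by rw [mul_comm ρ, hQρ, one_mul]
          have e'' : Z * (ρ * ‖Q‖ * a * b) = Z * (a * b) := by rw [e']
          nlinarith
      _ ≤ _ := mul_le_mul_of_nonneg_left hM (mul_nonneg h0.le (by linarith))
  have hcancel : ‖t‖ * (1 - ρ * Z) ≤ ρ * (Z - 1) :=
    le_of_mul_le_mul_right (by linarith) hM0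
  linarith

end InTransmissivityRegion

/-! ### The roots -/

namespace Graph

variable {α β : Type*} {G H : Graph α β} {s t : α}

lemma mul_parallel_denominator (q a₁ b₁ a₂ b₂ : ℂ) (h₁ : q * a₁ + b₁ ≠ 0)
    (h₂ : q * a₂ + b₂ ≠ 0) :
    q * (q * (a₁ * a₂) + ((a₁ + b₁) * (a₂ + b₂) - a₁ * a₂)) = (q * a₁ + b₁) * (q * a₂ + b₂) *
      (1 + (q - 1) * (b₁ / (q * a₁ + b₁)) * (b₂ / (q * a₂ + b₂))) := by
  field_simp
  ring

open InTransmissivityRegion in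
/-- The transmissivities of the 2-terminal subgraphs of a host graph with maxmaxflow at most `Λ`
are well defined, and lie in the appropriate region when the terminals are also joined outside. -/
theorem InWheatstoneClass.exists_isTerminalCount {Λ : ℕ} (hΛ : 3 ≤ Λ)
    (hflow : H.maxmaxflow ≤ Λ) {q : ℂ} {Y : ℝ} (hq : 2 ≤ ‖q - 1‖) (hY : 1 ≤ Y)
    (hY1 : 1 + ‖q - 1‖⁻¹ ≤ Y * (1 + ‖q - 1‖⁻¹ ^ 2))
    (hY2 : 1 + ‖q - 1‖⁻¹ ≤ Y ^ 2 * (1 - ‖q - 1‖⁻¹ + 2 * ‖q - 1‖⁻¹ ^ 2))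
    (hYΛ : Y ^ (Λ - 1) * (1 + ‖q - 1‖⁻¹) ≤ 2) (hG : G.InWheatstoneClass s t) :
    G ≤ H → ∃ A B : ℤ[X], G.IsTerminalCount s t A B ∧
      q * Polynomial.aeval q A + Polynomial.aeval q B ≠ 0 ∧
      (H.JoinedOff E(G) s t → ∃ k, 1 ≤ k ∧ k + 1 ≤ Λ ∧ G.HasEdgeDisjointPaths s t k ∧
        InTransmissivityRegion (q - 1) Y k
          (Polynomial.aeval q B / (q * Polynomial.aeval q A + Polynomial.aeval q B))) := by
  have hQ : 1 < ‖q - 1‖ := by linarith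
  have hQ0 : q - 1 ≠ 0 := norm_pos_iff.1 (by linarith)
  have hQ1 : q - 2 ≠ 0 := by
    intro h
    have : q - 1 = 1 := by linear_combination h
    rw [this, norm_one] at hQ
    exact lt_irrefl _ hQ
  have hq0 : q ≠ 0 := by
    rintro rfl
    simp at hQ
  have hpow : ∀ k, k + 1 ≤ Λ → Y ^ k * (1 + ‖q - 1‖⁻¹) ≤ 2 := fun k hk ↦
    le_trans (by gcongr 1; exact pow_le_pow_right₀ hY (by omega)) hYΛ
  have hsucc : ∀ {G : Graph α β} {s t : α} {k : ℕ}, G.InWheatstoneClass s t → G ≤ H →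
      G.HasEdgeDisjointPaths s t k → H.JoinedOff E(G) s t → k + 1 ≤ Λ := fun hG hle hp hj ↦
    (hp.succ_of_joinedOff hle hj).le_of_maxmaxflow_le (hle.vertexSet_mono hG.left_mem)
      (hle.vertexSet_mono hG.right_mem) hG.ne hflow
  induction hG with
  | @edge s t e hst =>
    intro hle
    have hD : q * Polynomial.aeval q (1 : ℤ[X]) + Polynomial.aeval q (-1 : ℤ[X]) = q - 1 := by
      simp; ring
    refine ⟨1, -1, isTerminalCount_edge e hst, hD ▸ hQ0, fun _ ↦ ⟨1, le_rfl, by omega, ?_, ?_⟩⟩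
    · obtain ⟨_, _, p⟩ := (InWheatstoneClass.edge e hst).exists_isPath
      exact p.hasEdgeDisjointPaths_one
    · left
      rw [hD]
      simp [mul_div_cancel₀, hQ0]
  | @bridge G s t h =>
    intro hle
    have h2 : Polynomial.aeval q (2 : ℤ[X]) = 2 := map_ofNat _ 2
    have h3 : Polynomial.aeval q (3 : ℤ[X]) = 3 := map_ofNat _ 3
    have hB : Polynomial.aeval q (2 * (.X - 2) : ℤ[X]) = 2 * (q - 2) := by simp [h2]
    have hD : q * Polynomial.aeval q ((.X - 2) * (.X - 3) : ℤ[X]) +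
        Polynomial.aeval q (2 * (.X - 2) : ℤ[X]) = (q - 2) * ((q - 1) * (q - 2)) := by
      simp [h2, h3]; ring
    -- The bridge carries two edge-disjoint paths; `2 + 1 ≤ Λ` comes from `Λ ≥ 3`.
    refine ⟨_, _, h.isTerminalCount, ?_, fun _ ↦ ⟨2, by omega, by omega,
      h.hasEdgeDisjointPaths, ?_⟩⟩
    · rw [hD]
      exact mul_ne_zero hQ1 (mul_ne_zero hQ0 hQ1)
    · right
      rw [hD, hB, mul_comm 2, mul_div_mul_left _ _ hQ1, norm_div, norm_mul]
      have h2 : ‖q - 1‖ - 1 ≤ ‖q - 2‖ := by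
        have := norm_sub_norm_le (q - 1) 1
        rwa [norm_one, show q - 1 - 1 = q - 2 by ring] at this
      have hle1 := inv_mul_pow_le_one hQ (hpow 2 (by omega))
      rw [Complex.norm_ofNat]
      set R := ‖q - 1‖
      have hR : 0 < R - 1 := by linarith
      have hx : 2 / (R * ‖q - 2‖) ≤ 2 / (R * (R - 1)) := by gcongr
      set x := 2 / (R * ‖q - 2‖)
      have hY2' : R * (R + 1) ≤ Y ^ 2 * (R ^ 2 - R + 2) := by
        have e : R ^ 2 * (1 + R⁻¹) = R * (R + 1) := by field_simp
        have e' : R ^ 2 * (1 - R⁻¹ + 2 * R⁻¹ ^ 2) = R ^ 2 - R + 2 := by field_simp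
        rw [← e, ← e', mul_left_comm]
        gcongr
      -- After clearing denominators, `hY2` is the disc condition at the largest possible norm of
      -- the bridge's transmissivity.
      have hx0 : R⁻¹ + 2 / (R * (R - 1)) ≤ R⁻¹ * Y ^ 2 * (1 + 2 / (R * (R - 1))) := by
        have e : R⁻¹ + 2 / (R * (R - 1)) = (R * (R + 1)) / (R * R * (R - 1)) := by
          field_simp; ring
        have e' : R⁻¹ * Y ^ 2 * (1 + 2 / (R * (R - 1))) =
            (Y ^ 2 * (R ^ 2 - R + 2)) / (R * R * (R - 1)) := by
          field_simp
        rw [e, e']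
        gcongr
      nlinarith
  | @series K G₁ G₂ s m t hG₁ hG₂ hK hV ih₁ ih₂ =>
    intro hle
    have hle₁ := hK.left_le.trans hle
    have hle₂ := hK.right_le.trans hle
    obtain ⟨A₁, B₁, c₁, d₁, r₁⟩ := ih₁ hle₁
    obtain ⟨A₂, B₂, c₂, d₂, r₂⟩ := ih₂ hle₂
    have hGK : K.InWheatstoneClass s t := .series hG₁ hG₂ hK hV
    have hD : q * Polynomial.aeval q (.X * (A₁ * A₂) + A₁ * B₂ + B₁ * A₂ : ℤ[X]) +
        Polynomial.aeval q (B₁ * B₂) = (q * Polynomial.aeval q A₁ + Polynomial.aeval q B₁) *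
          (q * Polynomial.aeval q A₂ + Polynomial.aeval q B₂) := by
      simp; ring
    refine ⟨_, _, c₁.series hK hV hGK.finite_vertexSet hG₁.left_mem hG₂.right_mem c₂, ?_,
      fun hj ↦ ?_⟩
    · rw [hD]
      exact mul_ne_zero d₁ d₂
    obtain ⟨_, _, p₁⟩ := hG₁.exists_isPath
    obtain ⟨_, _, p₂⟩ := hG₂.exists_isPath
    -- Outside `G₁`, go from `s` to `t` off `K`, then back to `m` through `G₂`.
    have hj₁ : H.JoinedOff E(G₁) s m :=
      (hj.anti (hK.left_le.edgeSet_mono)).trans (p₂.joinedOff hle₂ hK.disjoint_edgeSet.symm).symm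
    have hj₂ : H.JoinedOff E(G₂) m t :=
      (p₁.joinedOff hle₁ hK.disjoint_edgeSet).symm.trans (hj.anti (hK.right_le.edgeSet_mono))
    obtain ⟨k, hk, hkΛ, hp₁, hr₁⟩ := r₁ hj₁
    obtain ⟨l, hl, hlΛ, hp₂, hr₂⟩ := r₂ hj₂
    rw [hD, map_mul, ← div_mul_div_comm]
    -- The narrower side sets the number of paths and supplies the region; the other contributes
    -- only its norm bound.
    rcases le_total k l with hkl | hkl
    · exact ⟨k, hk, hkΛ, hp₁.trans hK.left_le hK.right_le hK.disjoint_edgeSet (hp₂.anti hkl),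
        hr₁.series hQ hY hY1 hk (hpow k hkΛ) (hr₂.norm_le hQ (hpow l hlΛ))⟩
    · rw [mul_comm]
      exact ⟨l, hl, hlΛ, (hp₁.anti hkl).trans hK.left_le hK.right_le hK.disjoint_edgeSet hp₂,
        hr₂.series hQ hY hY1 hl (hpow l hlΛ) (hr₁.norm_le hQ (hpow k hkΛ))⟩
  | @parallel K G₁ G₂ s t hG₁ hG₂ hK hV ih₁ ih₂ =>
    intro hle
    have hle₁ := hK.left_le.trans hle
    have hle₂ := hK.right_le.trans hle
    obtain ⟨A₁, B₁, c₁, d₁, r₁⟩ := ih₁ hle₁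
    obtain ⟨A₂, B₂, c₂, d₂, r₂⟩ := ih₂ hle₂
    have hGK : K.InWheatstoneClass s t := .parallel hG₁ hG₂ hK hV
    obtain ⟨_, _, p₁⟩ := hG₁.exists_isPath
    obtain ⟨_, _, p₂⟩ := hG₂.exists_isPath
    -- Each constituent joins the terminals outside the other, so both regions are available even
    -- when `K` itself is not joined outside.
    obtain ⟨k, hk, hkΛ, hp₁, hr₁⟩ := r₁ (p₂.joinedOff hle₂ hK.disjoint_edgeSet.symm)
    obtain ⟨l, hl, hlΛ, hp₂, hr₂⟩ := r₂ (p₁.joinedOff hle₁ hK.disjoint_edgeSet)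
    have hne := one_add_mul_ne_zero hQ (hr₁.norm_le hQ (hpow k hkΛ)) (hr₂.norm_le hQ (hpow l hlΛ))
    have hD := mul_parallel_denominator q _ _ _ _ d₁ d₂
    rw [← map_mul, ← map_add, ← map_add, ← map_mul, ← map_sub] at hD
    have hD0 : q * Polynomial.aeval q (A₁ * A₂) +
        Polynomial.aeval q ((A₁ + B₁) * (A₂ + B₂) - A₁ * A₂) ≠ 0 :=
      right_ne_zero_of_mul (hD ▸ mul_ne_zero (mul_ne_zero d₁ d₂) hne)
    refine ⟨_, _, c₁.parallel hK hV c₂, hD0, fun hj ↦ ?_⟩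
    have hp := hp₁.union hK.left_le hK.right_le hK.disjoint_edgeSet hp₂
    have hklΛ := hsucc hGK hle hp hj
    refine ⟨k + l, by omega, hklΛ, hp, hr₁.parallel hQ hY (hpow _ hklΛ) hr₂ ?_⟩
    rw [div_mul_eq_mul_div, div_eq_iff hD0]
    refine mul_left_cancel₀ hq0 ?_
    rw [mul_left_comm q (_ + _ + _), hD]
    simp only [map_sub, map_mul, map_add]
    field_simp
    ring

/-- The chromatic polynomial of a graph in the Wheatstone class with maxmaxflow at most `Λ` does
not vanish at `q` if the transmissivity discs at `q` admit a suitable growth rate `Y`. -/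
lemma InWheatstoneClass.aeval_chromaticPolynomial_ne_zero {Λ : ℕ} (hΛ : 3 ≤ Λ)
    (hflow : G.maxmaxflow ≤ Λ) {q : ℂ} {Y : ℝ} (hq : 2 ≤ ‖q - 1‖) (hY : 1 ≤ Y)
    (hY1 : 1 + ‖q - 1‖⁻¹ ≤ Y * (1 + ‖q - 1‖⁻¹ ^ 2))
    (hY2 : 1 + ‖q - 1‖⁻¹ ≤ Y ^ 2 * (1 - ‖q - 1‖⁻¹ + 2 * ‖q - 1‖⁻¹ ^ 2))
    (hYΛ : Y ^ (Λ - 1) * (1 + ‖q - 1‖⁻¹) ≤ 2) (hG : G.InWheatstoneClass s t) :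
    Polynomial.aeval q G.chromaticPolynomial ≠ 0 := by
  obtain ⟨A, B, c, hD, -⟩ := hG.exists_isTerminalCount hΛ hflow hq hY hY1 hY2 hYΛ le_rfl
  rw [c.chromaticPolynomial_eq hG.left_mem hG.right_mem hG.finite_vertexSet hG.finite_edgeSet]
  have hq0 : q ≠ 0 := by
    rintro rfl
    norm_num at hq
  simpa [hq0] using hD

end Graph

/-! ### The growth rate -/

section growth

variable {ρ : ℝ}

lemma one_add_le_exp_mul_one_add_sq (h0 : 0 ≤ ρ) (h1 : ρ ≤ 1 / 2) :
    1 + ρ ≤ Real.exp (ρ - ρ ^ 2) * (1 + ρ ^ 2) := by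
  have h := Real.add_one_le_exp (ρ - ρ ^ 2)
  have h3 : 0 ≤ ρ ^ 3 * (1 - ρ) := mul_nonneg (pow_nonneg h0 3) (by linarith)
  nlinarith [mul_le_mul_of_nonneg_right h (by positivity : 0 ≤ 1 + ρ ^ 2)]

/-- This condition, from the bridge, dictates the exponent: `ρ - ρ ^ 2` is the second-order
expansion of half the logarithm of `(1 + ρ) / (1 - ρ + 2 ρ ^ 2)`. The quadratic bound on `exp`
leaves a surplus of order `ρ ^ 4`. -/
lemma one_add_le_exp_sq_mul (h0 : 0 ≤ ρ) (h1 : ρ ≤ 1 / 2) :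
    1 + ρ ≤ Real.exp (ρ - ρ ^ 2) ^ 2 * (1 - ρ + 2 * ρ ^ 2) := by
  rw [← Real.exp_nat_mul]
  have hx : 0 ≤ ((2 : ℕ) : ℝ) * (ρ - ρ ^ 2) := by push_cast; nlinarith
  have h := Real.quadratic_le_exp_of_nonneg hx
  set E := Real.exp (((2 : ℕ) : ℝ) * (ρ - ρ ^ 2))
  push_cast at h
  have hp : 0 ≤ ρ ^ 4 * (6 - 10 * ρ + 4 * ρ ^ 2) :=
    mul_nonneg (pow_nonneg h0 4) (by nlinarith)
  calc 1 + ρ ≤ 1 + ρ + ρ ^ 4 * (6 - 10 * ρ + 4 * ρ ^ 2) := by linarith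
    _ = (1 + 2 * (ρ - ρ ^ 2) + (2 * (ρ - ρ ^ 2)) ^ 2 / 2) * (1 - ρ + 2 * ρ ^ 2) := by ring
    _ ≤ _ := mul_le_mul_of_nonneg_right h (by nlinarith)

/-- With `L = log 2`, it rests on `log (1 + ρ) ≤ ρ - (1 - L) ρ ^ 2`. The coefficient `1 - L` makes
the total exponent equal to `L` when `hn` is an equality. -/
lemma exp_pow_mul_one_add_le_two {n : ℕ} (h0 : 0 < ρ) (h1 : ρ ≤ 1 / 3)
    (hn : (n + 1) * ρ ≤ Real.log 2 * (1 + ρ)) :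
    Real.exp (ρ - ρ ^ 2) ^ n * (1 + ρ) ≤ 2 := by
  have hL := Real.log_two_gt_d9
  set L := Real.log 2 with hLd
  have hx : 0 ≤ ρ - (1 - L) * ρ ^ 2 := by nlinarith
  have h := Real.quadratic_le_exp_of_nonneg hx
  have hle : 1 + ρ ≤ Real.exp (ρ - (1 - L) * ρ ^ 2) := by
    refine le_trans ?_ h
    -- Any factor `c` with `c ^ 2 / 2 ≥ 1 - L` suffices for the quadratic term; `22 / 25` is allowed
    -- by `ρ ≤ 1 / 3`.
    have h2 : 22 / 25 * ρ ≤ ρ - (1 - L) * ρ ^ 2 := by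
      nlinarith [mul_nonneg h0.le (sub_nonneg.2 h1), mul_pos (sub_pos.2 hL) (pow_pos h0 2)]
    have h3 : (22 / 25 * ρ) ^ 2 ≤ (ρ - (1 - L) * ρ ^ 2) ^ 2 := by gcongr
    nlinarith [sq_nonneg ρ]
  calc Real.exp (ρ - ρ ^ 2) ^ n * (1 + ρ)
      ≤ Real.exp (ρ - ρ ^ 2) ^ n * Real.exp (ρ - (1 - L) * ρ ^ 2) := by gcongr
    _ = Real.exp (n * (ρ - ρ ^ 2) + (ρ - (1 - L) * ρ ^ 2)) := by
      rw [Real.exp_add, Real.exp_nat_mul]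
    _ ≤ Real.exp L := by
      gcongr
      nlinarith
    _ = 2 := Real.exp_log two_pos

end growth

theorem theorem1p6 {α β : Type*} (G : Graph α β) (s t : α) (hG : G.InWheatstoneClass s t)
    (Λ : ℕ) (hΛ : 3 ≤ Λ) (hflow : G.maxmaxflow ≤ (Λ : ℕ∞))
    (q : ℂ) (hq : Polynomial.aeval q G.chromaticPolynomial = 0) :
    ‖q - 1‖ < ((Λ : ℝ) - Real.log 2) / Real.log 2 := by
  by_contra! h
  have hL := Real.log_two_gt_d9
  have hL' := Real.log_two_lt_d9
  have hΛ' : (3 : ℝ) ≤ Λ := by exact_mod_cast hΛ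
  rw [div_le_iff₀ (by linarith)] at h
  -- Since `log 2 < 3 / 4`, the radius exceeds `3` for `Λ ≥ 3`.
  have hR : 3 ≤ ‖q - 1‖ := by nlinarith
  have h0 : 0 < ‖q - 1‖⁻¹ := inv_pos.2 (by linarith)
  have h1 : ‖q - 1‖⁻¹ ≤ 1 / 3 := by
    rw [← one_div]
    gcongr
  refine hG.aeval_chromaticPolynomial_ne_zero hΛ hflow (q := q)
    (Y := Real.exp (‖q - 1‖⁻¹ - ‖q - 1‖⁻¹ ^ 2)) (by linarith) (Real.one_le_exp (by nlinarith))
    (one_add_le_exp_mul_one_add_sq h0.le (by linarith))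
    (one_add_le_exp_sq_mul h0.le (by linarith)) (exp_pow_mul_one_add_le_two h0 h1 ?_) hq
  have hc : ‖q - 1‖ * ‖q - 1‖⁻¹ = 1 := mul_inv_cancel₀ (by linarith)
  -- With `n = Λ - 1`, the claim is `Λ ρ ≤ log 2 * (1 + ρ)`, which is `h` divided by `‖q - 1‖`.
  rw [Nat.cast_sub (by omega), Nat.cast_one, sub_add_cancel]
  nlinarith [mul_le_mul_of_nonneg_right h h0.le]
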